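/- For integers $m,n\ge 0$ let $[n]_q=1+q+\cdots+q^{n-1}$, $[n]_q!=[1]_q[2]_q\cdots[n]_q$, $(x;q)_n=(1-x)(1-qx)\cdots(1-q^{n-1}x)$, ${m\brack n}_q=\frac{[m]_q!}{[n]_q!\,[m-n]_q!}$ for $n\le m$ and ${m\brack n}_q=0$ for $n>m$, and let $C_n(q)=\frac{1}{[n+1]_q}{2n\brack n}_q$ be the $q$-Catalan number. For integers $0\le r\le n$ define the rational function in the indeterminate $q$ $$T_r(n,q)=q^{r^2-r}\,\frac{(-q^{n-r+1};q)_r}{(-q;q)_r}\,{n-r+1\brack r}_q\,C_{n-r}(q).$$ **Theorem.** Let $0\le r\le n$ be integers. Then $T_r(n,q)$ is a polynomial in $q$ with integer coefficients. If $n$ is even, all coefficients of $T_r(n,q)$ are nonnegative. If $n$ is odd, all coefficients of $(1+q)\,T_r(n,q)$ are nonnegative. Moreover, for every $r\ge 1$, $$T_r(2r-1,-q)=q^{r^2-r}\,[2r-1]_q\,C_{r-1}(q^2),$$ and $T_r(2r-1,-q)$ is a polynomial in $q$ with nonnegative (integer) coefficients. -/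

import Mathlib

open Polynomial

namespace KoshyQ

/-- The `q`-integer `[n]_q = 1 + q + ⋯ + q^(n-1)`. -/
def qInt {K : Type*} [Field K] (q : K) (n : ℕ) : K :=
  ∑ i ∈ Finset.range n, q ^ i

/-- The `q`-factorial `[n]_q! = [1]_q [2]_q ⋯ [n]_q`. -/
def qFact {K : Type*} [Field K] (q : K) (n : ℕ) : K :=
  ∏ i ∈ Finset.range n, qInt q (i + 1)

/-- The `q`-shifted factorial `(x; q)_n = (1 - x)(1 - q x) ⋯ (1 - q^(n-1) x)`. -/
def qPoch {K : Type*} [Field K] (x q : K) (n : ℕ) : K :=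
  ∏ i ∈ Finset.range n, (1 - q ^ i * x)

/-- The `q`-binomial coefficient `[m]_q! / ([n]_q! [m-n]_q!)`, which is zero for `n > m`. -/
def qBinom {K : Type*} [Field K] (q : K) (m n : ℕ) : K :=
  if n ≤ m then qFact q m / (qFact q n * qFact q (m - n)) else 0

/-- The `q`-Catalan number `C_n(q)`. -/
def qCatalan {K : Type*} [Field K] (q : K) (n : ℕ) : K :=
  1 / qInt q (n + 1) * qBinom q (2 * n) n

/-- Andrews' term `T_r(n, q)`, meaningful for `r ≤ n`. -/
def andrewsT {K : Type*} [Field K] (r n : ℕ) (q : K) : K :=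
  q ^ (r ^ 2 - r) * (qPoch (-q ^ (n - r + 1)) q r / qPoch (-q) q r)
    * qBinom q (n - r + 1) r * qCatalan q (n - r)

/-- The rational function `f` is a polynomial in `q` with integer coefficients. -/
def IsPoly (f : RatFunc ℚ) : Prop :=
  ∃ P : ℤ[X], f = aeval (RatFunc.X : RatFunc ℚ) P

/-- The rational function `f` is a positive polynomial: a polynomial in `q` with nonnegative
integer coefficients. -/
def IsPositivePoly (f : RatFunc ℚ) : Prop :=
  ∃ P : ℤ[X], (∀ k : ℕ, 0 ≤ P.coeff k) ∧ f = aeval (RatFunc.X : RatFunc ℚ) P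

end KoshyQ

/-! Write n = r + s. If r > s + 1 the term vanishes; otherwise put t = s + 1 - r. Cancelling
factorials gives [2s+1]_q T = q^(r²-r) G(q) H(q²), with G the Gaussian binomial of 2s+1 over t and H
that of n over r. Let d = gcd(2s+1, n), which is odd and prime to r. Then P = [d]G/[2s+1] and Q =
H/[d] are polynomials, and [d]_{q²} = [d]_q [d]_{-q} yields T = q^(r²-r) P(q) Q(q²) [d]_{-q}.
Multiplying by 1 + q turns the last factor into 1 + q^d. For even n > 0 the factors are distributed
differently, so that 1 + q^n appears without the extra 1 + q. Such quotients are nonnegative because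
Gaussian polynomials are symmetric and unimodal (`coeff_nonneg_of_qNum_mul_eq`). Unimodality comes
from an sl₂-action on forms of degree m in x_0, …, x_n: below the middle weight the raising operator
is injective. -/

namespace KoshyQ

/-! ### The sl₂-action on forms and injectivity below the middle weight -/

section Sl2

open MvPolynomial

/-- The exponent vectors of the monomials of degree `m` and weight `k` in the variables
`x_0, …, x_n`, the variable `x_i` having weight `i`. -/
def boxExponents (n m k : ℕ) : Set (ℕ →₀ ℕ) :=
  {a | a.degree = m ∧ Finsupp.weight (id : ℕ → ℕ) a = k ∧ a.support ⊆ Finset.range (n + 1)}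

/-- The raising operator `x_i ↦ (n - i) x_{i+1}`. -/
noncomputable def raise (n : ℕ) :
    Derivation ℚ (MvPolynomial ℕ ℚ) (MvPolynomial ℕ ℚ) :=
  mkDerivation ℚ fun i => ((n : ℚ) - i) • MvPolynomial.X (i + 1)

/-- The lowering operator `x_i ↦ i x_{i-1}`. -/
noncomputable def lower : Derivation ℚ (MvPolynomial ℕ ℚ) (MvPolynomial ℕ ℚ) :=
  mkDerivation ℚ fun i => (i : ℚ) • MvPolynomial.X (i - 1)

/-- The weight operator `x_i ↦ (2 i - n) x_i`. -/
noncomputable def weightOp (n : ℕ) :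
    Derivation ℚ (MvPolynomial ℕ ℚ) (MvPolynomial ℕ ℚ) :=
  mkDerivation ℚ fun i => (2 * (i : ℚ) - n) • MvPolynomial.X i

theorem lie_raise_lower (n : ℕ) : ⁅raise n, lower⁆ = weightOp n := by
  refine MvPolynomial.derivation_ext fun i => ?_
  rw [Derivation.commutator_apply]
  simp only [raise, lower, weightOp, MvPolynomial.mkDerivation_X, Derivation.map_smul, smul_smul]
  rcases i with _ | i
  · simp
  · simp only [Nat.add_sub_cancel, ← sub_smul]
    congr 1
    push_cast
    ring

theorem raise_lower (n : ℕ) (v : MvPolynomial ℕ ℚ) :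
    raise n (lower v) = lower (raise n v) + weightOp n v := by
  rw [← lie_raise_lower, Derivation.commutator_apply]
  ring

/-- Applied to a monomial, such a derivation replaces one factor x_i by x_{f i}, so only these
replacements with c_i ≠ 0 need checking. -/
theorem mkDerivation_mem_restrictSupport {s t : Set (ℕ →₀ ℕ)} {c : ℕ → ℚ} {f : ℕ → ℕ}
    (h : ∀ b i, b + Finsupp.single i 1 ∈ s → c i = 0 ∨ b + Finsupp.single (f i) 1 ∈ t)
    {v : MvPolynomial ℕ ℚ} (hv : v ∈ restrictSupport ℚ s) :
    mkDerivation ℚ (fun i => c i • (MvPolynomial.X (f i) : MvPolynomial ℕ ℚ)) v ∈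
      restrictSupport ℚ t := by
  rw [restrictSupport_eq_span] at hv
  induction hv using Submodule.span_induction with
  | mem x hx =>
    obtain ⟨a, ha, rfl⟩ := hx
    dsimp only
    rw [MvPolynomial.mkDerivation_monomial]
    refine Submodule.smul_mem _ _ (Submodule.sum_mem _ fun i hi => ?_)
    have hai : a - Finsupp.single i 1 + Finsupp.single i 1 = a := by
      refine tsub_add_cancel_of_le (Finsupp.single_le_iff.2 ?_)
      exact Nat.one_le_iff_ne_zero.2 (Finsupp.mem_support_iff.1 hi)
    dsimp only
    rw [smul_eq_mul, mul_smul_comm, MvPolynomial.X, MvPolynomial.monomial_mul, MvPolynomial.smul_monomial,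
      monomial_mem_restrictSupport]
    rcases h (a - Finsupp.single i 1) i (by rwa [hai]) with h | h
    · exact Or.inr (by simp [h])
    · exact Or.inl h
  | zero => simp
  | add x y _ _ hx hy => rw [map_add]; exact add_mem hx hy
  | smul c x _ hx => rw [Derivation.map_smul]; exact Submodule.smul_mem _ _ hx

theorem add_single_mem_boxExponents {n m k i : ℕ} {b : ℕ →₀ ℕ} :
    b + Finsupp.single i 1 ∈ boxExponents n m k ↔
      b.degree + 1 = m ∧ Finsupp.weight (id : ℕ → ℕ) b + i = k ∧
        b.support ⊆ Finset.range (n + 1) ∧ i ≤ n := by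
  have hs : (b + Finsupp.single i 1).support = b.support ∪ {i} := by
    ext j
    by_cases hj : i = j <;> simp [hj, eq_comm]
  simp only [boxExponents, Set.mem_ofPred_eq, hs, map_add, Finsupp.degree_single,
    Finsupp.weight_single, Finset.union_subset_iff, Finset.singleton_subset_iff, Finset.mem_range,
    Nat.lt_succ_iff, id, smul_eq_mul, one_mul]

theorem raise_mem {n m k : ℕ} {v : MvPolynomial ℕ ℚ}
    (hv : v ∈ restrictSupport ℚ (boxExponents n m k)) :
    raise n v ∈ restrictSupport ℚ (boxExponents n m (k + 1)) := by
  refine mkDerivation_mem_restrictSupport (fun b i h => ?_) hv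
  rw [add_single_mem_boxExponents] at h ⊢
  obtain rfl | hi := eq_or_ne i n
  · simp
  · exact Or.inr ⟨h.1, by omega, h.2.2.1, by omega⟩

theorem lower_mem {n m k : ℕ} {v : MvPolynomial ℕ ℚ}
    (hv : v ∈ restrictSupport ℚ (boxExponents n m (k + 1))) :
    lower v ∈ restrictSupport ℚ (boxExponents n m k) := by
  refine mkDerivation_mem_restrictSupport (fun b i h => ?_) hv
  rw [add_single_mem_boxExponents] at h ⊢
  obtain rfl | hi := eq_or_ne i 0
  · simp
  · exact Or.inr ⟨h.1, by omega, h.2.2.1, by omega⟩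

theorem lower_eq_zero {n m : ℕ} {v : MvPolynomial ℕ ℚ}
    (hv : v ∈ restrictSupport ℚ (boxExponents n m 0)) : lower v = 0 := by
  have h : lower v ∈ restrictSupport ℚ (∅ : Set (ℕ →₀ ℕ)) := by
    refine mkDerivation_mem_restrictSupport (fun b i h => ?_) hv
    rw [add_single_mem_boxExponents] at h
    exact Or.inl (by exact_mod_cast (add_eq_zero.1 h.2.1).2)
  simpa [mem_restrictSupport_iff] using h

theorem weightOp_eq_smul {n m k : ℕ} {v : MvPolynomial ℕ ℚ}
    (hv : v ∈ restrictSupport ℚ (boxExponents n m k)) :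
    weightOp n v = (2 * (k : ℚ) - n * m) • v := by
  rw [restrictSupport_eq_span] at hv
  induction hv using Submodule.span_induction with
  | mem x hx =>
    obtain ⟨a, ha, rfl⟩ := hx
    have h1 : ∀ i ∈ a.support, MvPolynomial.monomial (a - Finsupp.single i 1) (a i : ℚ) •
        ((2 * (i : ℚ) - n) • (MvPolynomial.X i : MvPolynomial ℕ ℚ)) =
        ((a i : ℚ) * (2 * (i : ℚ) - n)) • MvPolynomial.monomial a 1 := by
      intro i hi
      have hai : a - Finsupp.single i 1 + Finsupp.single i 1 = a := by
        refine tsub_add_cancel_of_le (Finsupp.single_le_iff.2 ?_)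
        exact Nat.one_le_iff_ne_zero.2 (Finsupp.mem_support_iff.1 hi)
      rw [smul_eq_mul, mul_smul_comm, MvPolynomial.X, MvPolynomial.monomial_mul, hai, MvPolynomial.smul_monomial,
        MvPolynomial.smul_monomial]
      congr 1
      simp [mul_comm]
    dsimp only
    rw [weightOp, MvPolynomial.mkDerivation_monomial, one_smul, Finsupp.sum, Finset.sum_congr rfl h1,
      ← Finset.sum_smul]
    congr 1
    have hd : (m : ℚ) = ∑ i ∈ a.support, (a i : ℚ) := by
      rw [← ha.1, Finsupp.degree_apply]; push_cast; rfl
    have hw : (k : ℚ) = ∑ i ∈ a.support, (a i : ℚ) * i := by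
      rw [← ha.2.1, Finsupp.weight_apply, Finsupp.sum]; simp
    rw [hd, hw, Finset.mul_sum, Finset.mul_sum, ← Finset.sum_sub_distrib]
    exact Finset.sum_congr rfl fun i _ => by ring
  | zero => simp
  | add x y _ _ hx hy => rw [map_add, hx, hy, smul_add]
  | smul c x _ hx => rw [Derivation.map_smul, hx, smul_comm]

theorem iterate_lower_mem {n m k j : ℕ} {v : MvPolynomial ℕ ℚ}
    (hv : v ∈ restrictSupport ℚ (boxExponents n m (k + j))) :
    lower^[j] v ∈ restrictSupport ℚ (boxExponents n m k) := by
  induction j generalizing v with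
  | zero => exact hv
  | succ j ih => exact ih (lower_mem hv)

/-- The usual sl₂ computation on the string below a vector killed by `raise`: each step adds the
eigenvalue of `weightOp` on `lower^[j + 1] v`. -/
theorem raise_iterate_lower {n m k : ℕ} {v : MvPolynomial ℕ ℚ}
    (hv : v ∈ restrictSupport ℚ (boxExponents n m k)) (h0 : raise n v = 0) {j : ℕ} (hj : j ≤ k) :
    raise n (lower^[j + 1] v) =
      (((j : ℚ) + 1) * (2 * (k : ℚ) - n * m - j)) • lower^[j] v := by
  induction j with
  | zero => simp [raise_lower, h0, weightOp_eq_smul hv]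
  | succ j ih =>
    have hmem : lower^[j + 1] v ∈ restrictSupport ℚ (boxExponents n m (k - (j + 1))) :=
      iterate_lower_mem (by rwa [Nat.sub_add_cancel hj])
    rw [Function.iterate_succ_apply', raise_lower, ih (by omega), weightOp_eq_smul hmem,
      Derivation.map_smul, ← Function.iterate_succ_apply' (f := lower), ← add_smul]
    congr 1
    push_cast [Nat.cast_sub hj]
    ring

/-- Lowering k + 1 times leaves the nonnegative weights and gives 0. The scalars in
`raise_iterate_lower` are nonzero because 2k < nm, so this vanishing climbs back up the string to v.
-/
theorem eq_zero_of_raise_eq_zero {n m k : ℕ} (hk : 2 * k < n * m) {v : MvPolynomial ℕ ℚ}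
    (hv : v ∈ restrictSupport ℚ (boxExponents n m k)) (h0 : raise n v = 0) : v = 0 := by
  have key : ∀ j ≤ k + 1, lower^[k + 1 - j] v = 0 := by
    intro j hj
    induction j with
    | zero =>
      rw [Nat.sub_zero, Function.iterate_succ_apply']
      exact lower_eq_zero (iterate_lower_mem (by rwa [zero_add]))
    | succ j ih =>
      have h := raise_iterate_lower hv h0 (j := k - j) (by omega)
      rw [show k - j + 1 = k + 1 - j by omega, ih (by omega), map_zero] at h
      rw [show k + 1 - (j + 1) = k - j by omega]
      refine (smul_eq_zero.1 h.symm).resolve_left (mul_ne_zero (by positivity) ?_)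
      have h1 : (2 * (k : ℚ)) < n * m := by exact_mod_cast hk
      have h2 : (0 : ℚ) ≤ ((k - j : ℕ) : ℚ) := by positivity
      intro h3
      linarith
  simpa using key (k + 1) le_rfl

/-- The exponent vectors of all monomials of degree `m` in `x_0, …, x_n`. -/
def box (n m : ℕ) : Finset (ℕ →₀ ℕ) := Finset.finsuppAntidiag (Finset.range (n + 1)) m

theorem mem_box {n m : ℕ} {a : ℕ →₀ ℕ} :
    a ∈ box n m ↔ a.degree = m ∧ a.support ⊆ Finset.range (n + 1) := by
  rw [box, Finset.mem_finsuppAntidiag', Finsupp.degree_apply]; rfl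

theorem coe_box_filter (n m k : ℕ) :
    (((box n m).filter fun a => Finsupp.weight (id : ℕ → ℕ) a = k : Finset _) :
      Set (ℕ →₀ ℕ)) = boxExponents n m k := by
  ext a
  simp only [Finset.coe_filter, mem_box, boxExponents, Set.mem_ofPred_eq]
  tauto

theorem finite_boxExponents (n m k : ℕ) : (boxExponents n m k).Finite := by
  rw [← coe_box_filter]; exact Finset.finite_toSet _

theorem ncard_boxExponents_le_succ {n m k : ℕ} (hk : 2 * k < n * m) :
    (boxExponents n m k).ncard ≤ (boxExponents n m (k + 1)).ncard := by
  have := (finite_boxExponents n m k).to_subtype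
  have := (finite_boxExponents n m (k + 1)).to_subtype
  have hr : ∀ l, Module.finrank ℚ (restrictSupport ℚ (boxExponents n m l)) =
      (boxExponents n m l).ncard := fun l => by
    rw [Module.finrank_eq_nat_card_basis (basisRestrictSupport ℚ (boxExponents n m l)),
      Set.ncard, Nat.card, Set.encard, ENat.card]
    rfl
  rw [← hr, ← hr]
  have := Module.Finite.of_basis (basisRestrictSupport ℚ (boxExponents n m (k + 1)))
  let f : restrictSupport ℚ (boxExponents n m k) →ₗ[ℚ]
      restrictSupport ℚ (boxExponents n m (k + 1)) :=
    (raise n).toLinearMap.restrict fun v hv => raise_mem hv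
  refine LinearMap.finrank_le_finrank_of_injective (f := f) ?_
  rw [← LinearMap.ker_eq_bot, LinearMap.ker_eq_bot']
  intro v hv
  exact Subtype.ext (eq_zero_of_raise_eq_zero hk v.2 (congrArg Subtype.val hv))

end Sl2

/-! ### Gaussian polynomials as generating functions -/

/-- The Gaussian polynomial with `coeff k` the number of partitions of `k` in an `n × m` box. -/
noncomputable def gauss (n m : ℕ) : ℤ[X] :=
  ∑ a ∈ box n m, X ^ Finsupp.weight (id : ℕ → ℕ) a

theorem coeff_gauss (n m k : ℕ) : (gauss n m).coeff k = (boxExponents n m k).ncard := by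
  rw [gauss, finsetSum_coeff, ← coe_box_filter, Set.ncard_coe_finset, Finset.card_filter]
  simp [coeff_X_pow, eq_comm]

theorem coeff_gauss_nonneg (n m k : ℕ) : 0 ≤ (gauss n m).coeff k := by
  rw [coeff_gauss]; positivity

theorem coeff_gauss_le_succ {n m k : ℕ} (hk : 2 * k < n * m) :
    (gauss n m).coeff k ≤ (gauss n m).coeff (k + 1) := by
  rw [coeff_gauss, coeff_gauss]
  exact_mod_cast ncard_boxExponents_le_succ hk

theorem gauss_zero_right (n : ℕ) : gauss n 0 = 1 := by
  simp [gauss, box]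

theorem gauss_zero_left (m : ℕ) : gauss 0 m = 1 := by
  have : box 0 m = {Finsupp.single 0 m} := by
    ext a
    rw [mem_box, Finset.mem_singleton]
    constructor
    · rintro ⟨h, hs⟩
      have : a = Finsupp.single 0 (a 0) := by
        ext i
        rcases i with _ | i
        · simp
        · by_contra h
          have := hs (show i + 1 ∈ _ from Finsupp.mem_support_iff.2 fun h0 => h (by simp [h0]))
          simp at this
      rw [this, Finsupp.degree_single] at h
      rw [this, h]
    · rintro rfl
      exact ⟨Finsupp.degree_single _ _, Finsupp.support_single_subset⟩
  simp [gauss, this, Finsupp.weight_single]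

/-- Monomials are split according to whether x_{n+1} divides them; dividing it out lowers the weight
by n + 1. -/
theorem gauss_succ_succ (n m : ℕ) :
    gauss (n + 1) (m + 1) = gauss n (m + 1) + X ^ (n + 1) * gauss (n + 1) m := by
  have hd : Disjoint (box n (m + 1))
      ((box (n + 1) m).map (addRightEmbedding (Finsupp.single (n + 1) 1))) := by
    rw [Finset.disjoint_left]
    intro a ha hb
    obtain ⟨b, -, rfl⟩ := Finset.mem_map.1 hb
    have := (mem_box.1 ha).2 (show n + 1 ∈ _ from Finsupp.mem_support_iff.2 (by simp))
    simp at this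
  have hu : box (n + 1) (m + 1) = (box n (m + 1)).disjUnion
      ((box (n + 1) m).map (addRightEmbedding (Finsupp.single (n + 1) 1))) hd := by
    ext a
    simp only [Finset.mem_disjUnion, Finset.mem_map, mem_box, addRightEmbedding_apply]
    constructor
    · rintro ⟨h, hs⟩
      by_cases ha : a (n + 1) = 0
      · refine Or.inl ⟨h, fun i hi => ?_⟩
        have h1 := Finset.mem_range.1 (hs hi)
        have h2 : i ≠ n + 1 := by rintro rfl; exact Finsupp.mem_support_iff.1 hi ha
        exact Finset.mem_range.2 (by omega)
      · have hai : a - Finsupp.single (n + 1) 1 + Finsupp.single (n + 1) 1 = a :=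
          tsub_add_cancel_of_le (Finsupp.single_le_iff.2 (Nat.one_le_iff_ne_zero.2 ha))
        refine Or.inr ⟨a - Finsupp.single (n + 1) 1, ⟨?_, ?_⟩, hai⟩
        · rw [← hai, map_add, Finsupp.degree_single] at h
          omega
        · exact (Finsupp.support_mono tsub_le_self).trans hs
    · rintro (⟨h, hs⟩ | ⟨b, ⟨h, hs⟩, rfl⟩)
      · exact ⟨h, hs.trans (Finset.range_subset_range.2 (by omega))⟩
      · refine ⟨by simp [h], Finsupp.support_add.trans (Finset.union_subset hs ?_)⟩
        refine Finsupp.support_single_subset.trans ?_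
        simp
  rw [gauss, hu, Finset.sum_disjUnion, Finset.sum_map, gauss, gauss, Finset.mul_sum]
  congr 1
  refine Finset.sum_congr rfl fun a _ => ?_
  simp [Finsupp.weight_single, pow_add, mul_comm]

/-! ### q-integers and their gcd -/

/-- The polynomial `1 + X + ⋯ + X^(n-1)`. -/
noncomputable def qNum (n : ℕ) : ℤ[X] := ∑ i ∈ Finset.range n, X ^ i

/-- The polynomial `[1][2]⋯[n]`. -/
noncomputable def qNumFact (n : ℕ) : ℤ[X] := ∏ i ∈ Finset.range n, qNum (i + 1)

theorem qNum_zero : qNum 0 = 0 := by simp [qNum]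

theorem qNum_one : qNum 1 = 1 := by simp [qNum]

theorem qNumFact_succ (n : ℕ) : qNumFact (n + 1) = qNumFact n * qNum (n + 1) :=
  Finset.prod_range_succ _ _

theorem qNum_add (a b : ℕ) : qNum (a + b) = qNum a + X ^ a * qNum b := by
  simp [qNum, Finset.sum_range_add, pow_add, Finset.mul_sum]

theorem qNum_mul (a b : ℕ) : qNum (a * b) = qNum a * (qNum b).comp (X ^ a) := by
  induction b with
  | zero => simp [qNum_zero]
  | succ b ih =>
    have h : (qNum (b + 1)).comp (X ^ a) = (qNum b).comp (X ^ a) + X ^ (a * b) := by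
      simp [qNum, Finset.sum_range_succ, pow_mul]
    rw [Nat.mul_succ, qNum_add, ih, h]
    ring

theorem eval_one_qNum (n : ℕ) : (qNum n).eval 1 = n := by
  simp [qNum, eval_finsetSum]

theorem qNum_ne_zero {n : ℕ} (hn : n ≠ 0) : qNum n ≠ 0 := fun h => by
  have := eval_one_qNum n
  rw [h, eval_zero] at this
  exact hn (by exact_mod_cast this.symm)

theorem qNumFact_ne_zero (n : ℕ) : qNumFact n ≠ 0 :=
  Finset.prod_ne_zero_iff.2 fun i _ => qNum_ne_zero i.succ_ne_zero

theorem mul_qNum (n : ℕ) : (1 - X) * qNum n = 1 - X ^ n := mul_neg_geom_sum X n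

theorem qNum_dvd_qNum {a b : ℕ} (h : a ∣ b) : qNum a ∣ qNum b := by
  obtain ⟨c, rfl⟩ := h
  exact ⟨_, qNum_mul a c⟩

/-- Euclid's algorithm on indices lifts to q-integers, since [b] ≡ [b mod a] modulo [a]. The Bézout
identity holds over ℤ. -/
theorem exists_qNum_gcd (a b : ℕ) : ∃ u v : ℤ[X], qNum (a.gcd b) = u * qNum a + v * qNum b := by
  induction a, b using Nat.gcd.induction with
  | H0 b => exact ⟨0, 1, by simp⟩
  | H1 a b ha ih =>
    obtain ⟨u, v, h⟩ := ih
    obtain ⟨w, hw⟩ := qNum_dvd_qNum (Dvd.intro (b / a) rfl : a ∣ a * (b / a))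
    have hb : qNum b = qNum (b % a) + X ^ (b % a) * (qNum a * w) := by
      rw [← hw, ← qNum_add, Nat.mod_add_div]
    refine ⟨v - u * X ^ (b % a) * w, u, ?_⟩
    rw [Nat.gcd_rec, h, hb]
    ring

theorem isCoprime_qNum {a b : ℕ} (h : a.Coprime b) : IsCoprime (qNum a) (qNum b) := by
  obtain ⟨u, v, huv⟩ := exists_qNum_gcd a b
  rw [h.gcd_eq_one, qNum_one] at huv
  exact ⟨u, v, huv.symm⟩

/-- If `[a] A` and `[b] A` are both divisible by `p`, then so is `[gcd(a, b)] A`. -/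
theorem dvd_qNum_gcd_mul {a b : ℕ} {p A : ℤ[X]} (ha : p ∣ qNum a * A) (hb : p ∣ qNum b * A) :
    p ∣ qNum (a.gcd b) * A := by
  obtain ⟨u, v, h⟩ := exists_qNum_gcd a b
  rw [h, add_mul, mul_assoc, mul_assoc]
  exact dvd_add (ha.mul_left u) (hb.mul_left v)

/-! ### Factorial formula, symmetry and unimodality -/

theorem gauss_mul_qNumFact (n m : ℕ) :
    gauss n m * (qNumFact n * qNumFact m) = qNumFact (n + m) := by
  induction n generalizing m with
  | zero => simp [gauss_zero_left, qNumFact]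
  | succ n ihn =>
    induction m with
    | zero => simp [gauss_zero_right, qNumFact]
    | succ m ihm =>
      have h1 := ihn (m + 1)
      have h3 : qNumFact (n + 1 + (m + 1)) = qNumFact (n + (m + 1)) *
          (qNum (n + 1) + X ^ (n + 1) * qNum (m + 1)) := by
        rw [← qNum_add, show n + 1 + (m + 1) = n + (m + 1) + 1 by omega, ← qNumFact_succ]
      rw [show n + 1 + m = n + (m + 1) by omega] at ihm
      rw [h3, gauss_succ_succ, mul_add]
      nth_rw 1 [← h1]
      rw [← ihm, qNumFact_succ n, qNumFact_succ m]
      ring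

theorem gauss_comm (n m : ℕ) : gauss n m = gauss m n := by
  refine mul_right_cancel₀ (mul_ne_zero (qNumFact_ne_zero n) (qNumFact_ne_zero m)) ?_
  rw [gauss_mul_qNumFact, mul_comm (qNumFact n), gauss_mul_qNumFact, add_comm]

theorem gauss_succ_succ' (n m : ℕ) :
    gauss (n + 1) (m + 1) = gauss (n + 1) m + X ^ (m + 1) * gauss n (m + 1) := by
  rw [gauss_comm, gauss_succ_succ, gauss_comm m, gauss_comm _ n]

theorem coeff_gauss_eq_zero {n m k : ℕ} (hk : n * m < k) : (gauss n m).coeff k = 0 := by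
  induction n generalizing m k with
  | zero => rw [gauss_zero_left, coeff_one, if_neg (by omega)]
  | succ n ihn =>
    induction m generalizing k with
    | zero => rw [gauss_zero_right, coeff_one, if_neg (by omega)]
    | succ m ihm =>
      have h : n + 1 ≤ k := by nlinarith
      rw [gauss_succ_succ, coeff_add, ihn (by nlinarith), coeff_X_pow_mul', if_pos h,
        ihm (by rw [Nat.mul_succ] at hk; omega), add_zero]

/-- The two q-Pascal recursions are exchanged by the reflection k ↦ nm - k, so expanding one side by
each matches the terms. -/
theorem coeff_gauss_symm {n m i j : ℕ} (h : i + j = n * m) :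
    (gauss n m).coeff i = (gauss n m).coeff j := by
  induction n generalizing m i j with
  | zero => rw [show i = j by omega]
  | succ n ihn =>
    induction m generalizing i j with
    | zero => rw [show i = j by omega]
    | succ m ihm =>
      nth_rw 1 [gauss_succ_succ]
      rw [gauss_succ_succ', coeff_add, coeff_add, add_comm, coeff_X_pow_mul', coeff_X_pow_mul']
      have e1 : (n + 1) * (m + 1) = (n + 1) * m + (n + 1) := by ring
      have e2 : (n + 1) * (m + 1) = n * (m + 1) + (m + 1) := by ring
      congr 1
      · split_ifs with hi
        · exact ihm (by omega)
        · exact (coeff_gauss_eq_zero (by omega)).symm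
      · split_ifs with hj
        · exact ihn (by omega)
        · exact coeff_gauss_eq_zero (by omega)

theorem coeff_gauss_mono {n m i j : ℕ} (hij : i ≤ j) (h : i + j ≤ n * m) :
    (gauss n m).coeff i ≤ (gauss n m).coeff j := by
  -- The bound nm + 1 allows for the last increase, which may land just past the middle.
  have key : ∀ j, i ≤ j → 2 * j ≤ n * m + 1 → (gauss n m).coeff i ≤ (gauss n m).coeff j := by
    intro j hij hj
    induction j, hij using Nat.le_induction with
    | base => rfl
    | succ j _ ih => exact (ih (by omega)).trans (coeff_gauss_le_succ (by omega))
  rcases le_total (2 * j) (n * m) with hj | hj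
  · exact key j hij (by omega)
  · rw [coeff_gauss_symm (show j + (n * m - j) = n * m by omega)]
    exact key _ (by omega) (by omega)

theorem coeff_gauss_anti {n m i j : ℕ} (hij : i ≤ j) (h : n * m ≤ i + j) :
    (gauss n m).coeff j ≤ (gauss n m).coeff i := by
  rcases lt_or_ge (n * m) j with hj | hj
  · rw [coeff_gauss_eq_zero hj]; exact coeff_gauss_nonneg _ _ _
  · rw [coeff_gauss_symm (show j + (n * m - j) = n * m by omega)]
    exact coeff_gauss_mono (by omega) (by omega)

/-! ### Nonnegative quotients -/

/-- If `[M] P = [e] G` for a Gaussian polynomial `G`, which is symmetric and unimodal, then `P` has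
nonnegative coefficients. -/
theorem coeff_nonneg_of_qNum_mul_eq {n m e M : ℕ} {P : ℤ[X]} (hM : M ≠ 0)
    (h : qNum M * P = qNum e * gauss n m) (k : ℕ) : 0 ≤ P.coeff k := by
  -- Multiplying by 1 - X gives p_k - p_{k-M} = g_k - g_{k-e}, whose right side changes sign only at
  -- 2k = nm + e.
  have h1 : P - X ^ M * P = gauss n m - X ^ e * gauss n m := by
    have h2 := congrArg (fun p => (1 - X) * p) h
    simp only [← mul_assoc, mul_qNum] at h2
    linear_combination h2
  have hc : ∀ k, P.coeff k - (if M ≤ k then P.coeff (k - M) else 0) =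
      (gauss n m).coeff k - if e ≤ k then (gauss n m).coeff (k - e) else 0 := fun k => by
    have := congrArg (fun p => p.coeff k) h1
    simpa only [coeff_sub, coeff_X_pow_mul'] using this
  rcases le_total (2 * k) (n * m + e) with hk | hk
  · induction k using Nat.strong_induction_on with
    | _ k ih =>
      have h3 : (0 : ℤ) ≤ if M ≤ k then P.coeff (k - M) else 0 := by
        split_ifs
        · exact ih _ (by omega) (by omega)
        · rfl
      have h4 : (if e ≤ k then (gauss n m).coeff (k - e) else 0) ≤ (gauss n m).coeff k := by
        split_ifs
        · exact coeff_gauss_mono (by omega) (by omega)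
        · exact coeff_gauss_nonneg _ _ _
      linarith [hc k]
  -- Above the middle, p_k ≥ p_{k+M}; t drives a descending induction from beyond the degree of P.
  · have key : ∀ t k, P.natDegree < k + t → n * m + e ≤ 2 * k → 0 ≤ P.coeff k := by
      intro t
      induction t with
      | zero => intro k ht _; rw [coeff_eq_zero_of_natDegree_lt (by omega)]
      | succ t ih =>
        intro k ht hk
        have h3 := ih (k + M) (by omega) (by omega)
        have h4 := hc (k + M)
        rw [if_pos (by omega), Nat.add_sub_cancel] at h4
        have h5 : (gauss n m).coeff (k + M) ≤
            if e ≤ k + M then (gauss n m).coeff (k + M - e) else 0 := by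
          split_ifs
          · exact coeff_gauss_anti (by omega) (by omega)
          · exact (coeff_gauss_eq_zero (by omega)).le
        linarith
    exact key (P.natDegree + 1) k (by omega) hk

theorem coeff_nonneg_of_qNum_mul_eq_gauss {n m M : ℕ} {P : ℤ[X]} (hM : M ≠ 0)
    (h : qNum M * P = gauss n m) (k : ℕ) : 0 ≤ P.coeff k :=
  coeff_nonneg_of_qNum_mul_eq (e := 1) hM (by rw [qNum_one, one_mul, h]) k

/-! ### Divisibility of Gaussian polynomials -/

theorem qNum_mul_gauss_succ (n m : ℕ) :
    qNum (n + 1) * gauss (n + 1) m = qNum (n + 1 + m) * gauss n m := by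
  refine mul_right_cancel₀ (mul_ne_zero (qNumFact_ne_zero n) (qNumFact_ne_zero m)) ?_
  have h1 := gauss_mul_qNumFact n m
  have h2 := gauss_mul_qNumFact (n + 1) m
  rw [show n + 1 + m = n + m + 1 by omega, qNumFact_succ, qNumFact_succ] at h2
  rw [show n + 1 + m = n + m + 1 by omega]
  linear_combination h2 - qNum (n + m + 1) * h1

theorem qNum_add_dvd_qNum_mul_gauss (n m : ℕ) : qNum (n + m) ∣ qNum n * gauss n m := by
  rcases n with _ | n
  · simp [qNum_zero]
  · exact ⟨_, qNum_mul_gauss_succ n m⟩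

theorem qNum_dvd_gauss {e n m : ℕ} (he : e ∣ n + m) (h : e.Coprime n) : qNum e ∣ gauss n m :=
  (isCoprime_qNum h).dvd_of_dvd_mul_left
    ((qNum_dvd_qNum he).trans (qNum_add_dvd_qNum_mul_gauss n m))

theorem qNum_add_dvd_qNum_gcd_mul_gauss (n m : ℕ) :
    qNum (n + m) ∣ qNum ((n + m).gcd n) * gauss n m :=
  dvd_qNum_gcd_mul (dvd_mul_right _ _) (qNum_add_dvd_qNum_mul_gauss n m)

/-- The `q`-Catalan numbers are polynomials. -/
theorem qNum_succ_dvd_gauss_self (n : ℕ) : qNum (n + 1) ∣ gauss n n := by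
  have h : (n + 1).Coprime (n + 1 + n) := by
    rw [Nat.coprime_self_add_right]
    simp
  refine (isCoprime_qNum h).dvd_of_dvd_mul_left ?_
  exact ⟨_, (qNum_mul_gauss_succ n n).symm⟩

/-! ### Identities in a field where q is nonzero-power free of 1 -/

section Field

variable {K : Type*} [Field K] {q : K}

theorem aeval_qNum (q : K) (n : ℕ) : aeval q (qNum n) = qInt q n := by
  simp [qNum, qInt]

theorem aeval_qNumFact (q : K) (n : ℕ) : aeval q (qNumFact n) = qFact q n := by
  simp [qNumFact, qFact, aeval_qNum]

theorem one_sub_mul_qInt (q : K) (n : ℕ) : (1 - q) * qInt q n = 1 - q ^ n :=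
  mul_neg_geom_sum q n

theorem qInt_ne_zero (hq : ∀ k ≠ 0, q ^ k ≠ 1) {n : ℕ} (hn : n ≠ 0) : qInt q n ≠ 0 := by
  intro h
  have := one_sub_mul_qInt q n
  rw [h, mul_zero] at this
  exact hq n hn (sub_eq_zero.1 this.symm).symm

theorem qFact_ne_zero (hq : ∀ k ≠ 0, q ^ k ≠ 1) (n : ℕ) : qFact q n ≠ 0 :=
  Finset.prod_ne_zero_iff.2 fun i _ => qInt_ne_zero hq i.succ_ne_zero

theorem one_add_pow_ne_zero (hq : ∀ k ≠ 0, q ^ k ≠ 1) {n : ℕ} (hn : n ≠ 0) : 1 + q ^ n ≠ 0 := by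
  intro h
  refine hq (2 * n) (by omega) ?_
  rw [two_mul, pow_add]
  linear_combination (q ^ n - 1) * h

theorem one_add_ne_zero (hq : ∀ k ≠ 0, q ^ k ≠ 1) : 1 + q ≠ 0 := by
  simpa using one_add_pow_ne_zero hq one_ne_zero

theorem sq_pow_ne_one (hq : ∀ k ≠ 0, q ^ k ≠ 1) (k : ℕ) (hk : k ≠ 0) : (q ^ 2) ^ k ≠ 1 := by
  rw [← pow_mul]; exact hq _ (by omega)

theorem neg_pow_ne_one (hq : ∀ k ≠ 0, q ^ k ≠ 1) (k : ℕ) (hk : k ≠ 0) : (-q) ^ k ≠ 1 := by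
  intro h
  refine hq (2 * k) (by omega) ?_
  rw [pow_mul, ← neg_sq, ← pow_mul, mul_comm, pow_mul, h, one_pow]

theorem qBinom_add (hq : ∀ k ≠ 0, q ^ k ≠ 1) (n m : ℕ) :
    qBinom q (n + m) n = aeval q (gauss n m) := by
  rw [qBinom, if_pos (Nat.le_add_right n m), Nat.add_sub_cancel_left, div_eq_iff
    (mul_ne_zero (qFact_ne_zero hq n) (qFact_ne_zero hq m))]
  simp only [← aeval_qNumFact, ← map_mul, gauss_mul_qNumFact]

theorem one_sub_ne_zero (hq : ∀ k ≠ 0, q ^ k ≠ 1) : 1 - q ≠ 0 := fun h =>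
  hq 1 one_ne_zero (by rw [pow_one]; exact (sub_eq_zero.1 h).symm)

/-- `(1 + q) [n]_{q²} = (1 + q^n) [n]_q`. -/
theorem one_add_mul_qInt_sq (hq : ∀ k ≠ 0, q ^ k ≠ 1) (n : ℕ) :
    (1 + q) * qInt (q ^ 2) n = (1 + q ^ n) * qInt q n := by
  refine mul_left_cancel₀ (one_sub_ne_zero hq) ?_
  have h1 := one_sub_mul_qInt q n
  have h2 := one_sub_mul_qInt (q ^ 2) n
  rw [← pow_mul, mul_comm 2, pow_mul] at h2
  linear_combination h2 - (1 + q ^ n) * h1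

/-- `[2 n]_q = (1 + q) [n]_{q²}`. -/
theorem qInt_two_mul (hq : ∀ k ≠ 0, q ^ k ≠ 1) (n : ℕ) :
    qInt q (2 * n) = (1 + q) * qInt (q ^ 2) n := by
  refine mul_left_cancel₀ (one_sub_ne_zero hq) ?_
  have h1 := one_sub_mul_qInt q (2 * n)
  have h2 := one_sub_mul_qInt (q ^ 2) n
  rw [← pow_mul] at h2
  linear_combination h1 - h2

theorem one_add_mul_qInt_neg (q : K) {d : ℕ} (hd : Odd d) :
    (1 + q) * qInt (-q) d = 1 + q ^ d := by
  have h := one_sub_mul_qInt (-q) d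
  rw [hd.neg_pow] at h
  linear_combination h

theorem qInt_mul_qInt_neg (hq : ∀ k ≠ 0, q ^ k ≠ 1) {d : ℕ} (hd : Odd d) :
    qInt q d * qInt (-q) d = qInt (q ^ 2) d := by
  refine mul_left_cancel₀ (one_add_ne_zero hq) ?_
  rw [one_add_mul_qInt_sq hq, ← one_add_mul_qInt_neg q hd]
  ring

theorem qPoch_neg_mul_qFact (hq : ∀ k ≠ 0, q ^ k ≠ 1) (n : ℕ) :
    qPoch (-q) q n * qFact q n = (1 + q) ^ n * qFact (q ^ 2) n := by
  have h : ∀ i : ℕ, (1 - q ^ i * -q) * qInt q (i + 1) = (1 + q) * qInt (q ^ 2) (i + 1) :=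
    fun i => by rw [one_add_mul_qInt_sq hq]; ring
  rw [qPoch, qFact, qFact, ← Finset.prod_mul_distrib, Finset.prod_congr rfl fun i _ => h i,
    Finset.prod_mul_distrib, Finset.prod_const, Finset.card_range]

theorem qPoch_neg_ne_zero (hq : ∀ k ≠ 0, q ^ k ≠ 1) (n : ℕ) : qPoch (-q) q n ≠ 0 := by
  refine Finset.prod_ne_zero_iff.2 fun i _ => ?_
  have := one_add_pow_ne_zero hq i.succ_ne_zero
  rw [pow_succ] at this
  simpa using this

theorem qPoch_neg_add (q : K) (s r : ℕ) :
    qPoch (-q) q (s + r) = qPoch (-q) q s * qPoch (-q ^ (s + 1)) q r := by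
  rw [qPoch, Finset.prod_range_add, qPoch, qPoch]
  congr 1
  exact Finset.prod_congr rfl fun i _ => by ring

theorem qFact_succ (q : K) (n : ℕ) : qFact q (n + 1) = qFact q n * qInt q (n + 1) :=
  Finset.prod_range_succ _ _

/-- Every Pochhammer symbol becomes a quotient of factorials through (-q; q)_m = (1+q)^m [m]_{q²}! /
[m]_q!, and the powers of 1 + q cancel. -/
theorem andrewsT_mul_qInt (hq : ∀ k ≠ 0, q ^ k ≠ 1) {r s t : ℕ} (h : s + 1 = r + t) :
    andrewsT r (r + s) q * qInt q (2 * s + 1) =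
      q ^ (r ^ 2 - r) * aeval q (gauss (r + s) t) * aeval (q ^ 2) (gauss r s) := by
  have hq2 := sq_pow_ne_one hq
  have e1 := qPoch_neg_add q s r
  have e2 := qPoch_neg_mul_qFact hq (r + s)
  have e3 := qPoch_neg_mul_qFact hq r
  have e4 := qPoch_neg_mul_qFact hq s
  have e5 : aeval q (gauss (r + s) t) * (qFact q (r + s) * qFact q t) =
      qFact q (2 * s) * qInt q (2 * s + 1) := by
    rw [← qFact_succ, show 2 * s + 1 = r + s + t by omega]
    simp only [← aeval_qNumFact, ← map_mul, gauss_mul_qNumFact]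
  have e6 : aeval (q ^ 2) (gauss r s) * (qFact (q ^ 2) r * qFact (q ^ 2) s) =
      qFact (q ^ 2) (r + s) := by
    simp only [← aeval_qNumFact, ← map_mul, gauss_mul_qNumFact]
  have e7 := qFact_succ q s
  rw [andrewsT, qCatalan, qBinom, qBinom, Nat.add_sub_cancel_left, if_pos (by omega),
    if_pos (by omega), show s + 1 - r = t by omega, show 2 * s - s = s by omega, e7]
  have n1 := qFact_ne_zero hq r
  have n2 := qFact_ne_zero hq s
  have n3 := qFact_ne_zero hq t
  have n4 := qFact_ne_zero hq (r + s)
  have n5 := qFact_ne_zero hq2 r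
  have n6 := qFact_ne_zero hq2 s
  have n8 := qPoch_neg_ne_zero hq r
  have n9 := qPoch_neg_ne_zero hq s
  have n10 := qInt_ne_zero hq s.succ_ne_zero
  have n11 : (1 + q) ^ (r + s) ≠ 0 := pow_ne_zero _ (one_add_ne_zero hq)
  rw [← eq_div_iff (mul_ne_zero n4 n3)] at e5
  rw [← eq_div_iff (mul_ne_zero n5 n6)] at e6
  have e8 : qPoch (-q ^ (s + 1)) q r = qPoch (-q) q (r + s) / qPoch (-q) q s := by
    rw [eq_div_iff n9, add_comm r, e1, mul_comm]
  have e9 : ∀ m, qFact (q ^ 2) m = qPoch (-q) q m * qFact q m / (1 + q) ^ m := fun m => by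
    rw [qPoch_neg_mul_qFact hq, mul_div_cancel_left₀ _ (pow_ne_zero _ (one_add_ne_zero hq))]
  have n12 := one_add_ne_zero hq
  rw [e5, e6, e8, e9, e9, e9, pow_add]
  field_simp

theorem andrewsT_eq_zero {r s : ℕ} (h : s + 1 < r) (q : K) : andrewsT r (r + s) q = 0 := by
  rw [andrewsT, qBinom, if_neg (by omega)]
  simp

theorem qCatalan_eq (hq : ∀ k ≠ 0, q ^ k ≠ 1) (n : ℕ) :
    qInt q (n + 1) * qCatalan q n = aeval q (gauss n n) := by
  rw [qCatalan, two_mul, qBinom_add hq, ← mul_assoc,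
    mul_one_div_cancel (qInt_ne_zero hq n.succ_ne_zero), one_mul]

theorem andrewsT_eq_mul_qInt_neg (hq : ∀ k ≠ 0, q ^ k ≠ 1) {r s t d : ℕ} (h : s + 1 = r + t)
    (hd : Odd d) {P Q : ℤ[X]} (hP : qNum (2 * s + 1) * P = qNum d * gauss (r + s) t)
    (hQ : qNum d * Q = gauss r s) :
    andrewsT r (r + s) q =
      q ^ (r ^ 2 - r) * aeval q P * aeval (q ^ 2) Q * qInt (-q) d := by
  refine mul_right_cancel₀ (qInt_ne_zero hq (2 * s).succ_ne_zero) ?_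
  rw [andrewsT_mul_qInt hq h, ← hQ]
  have hP' := congrArg (aeval q) hP
  simp only [map_mul, aeval_qNum] at hP' ⊢
  rw [← qInt_mul_qInt_neg hq hd]
  linear_combination -(q ^ (r ^ 2 - r) * aeval (q ^ 2) Q * qInt (-q) d) * hP'

/-- Absorption removes [2s+1] from the first binomial at the cost of 1/[n]_q, where n = r + s. Then
[2g]_q = (1+q)[g]_{q²} and (1+q)[n]_{q²} = (1+q^n)[n]_q leave only 1 + q^n. -/
theorem andrewsT_eq_mul_one_add_pow (hq : ∀ k ≠ 0, q ^ k ≠ 1) {r s t g m : ℕ}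
    (h : s + 1 = r + t) (hm : m + 1 = r + s) (hg : g ≠ 0) {U V : ℤ[X]}
    (hU : qNum (2 * g) * U = gauss m t)
    (hV : qNum (r + s) * V = qNum g * gauss r s) :
    andrewsT r (r + s) q =
      q ^ (r ^ 2 - r) * aeval q U * aeval (q ^ 2) V * (1 + q ^ (r + s)) := by
  have n1 := qInt_ne_zero hq (2 * s).succ_ne_zero
  have n2 : qInt q (r + s) ≠ 0 := qInt_ne_zero hq (by omega)
  have n3 : qInt (q ^ 2) g ≠ 0 := qInt_ne_zero (sq_pow_ne_one hq) hg
  refine mul_right_cancel₀ (mul_ne_zero (mul_ne_zero n1 n2) n3) ?_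
  have h1 := andrewsT_mul_qInt hq h
  have h2 := congrArg (aeval q) (qNum_mul_gauss_succ m t)
  rw [← hU, hm, show r + s + t = 2 * s + 1 by omega] at h2
  have h3 := congrArg (aeval (q ^ 2)) hV
  simp only [map_mul, aeval_qNum] at h2 h3
  rw [qInt_two_mul hq] at h2
  have h4 := one_add_mul_qInt_sq hq (r + s)
  linear_combination (qInt q (r + s) * qInt (q ^ 2) g) * h1 +
    q ^ (r ^ 2 - r) * aeval (q ^ 2) (gauss r s) * qInt (q ^ 2) g * h2 -
    q ^ (r ^ 2 - r) * qInt q (2 * s + 1) * (1 + q) * qInt (q ^ 2) g * aeval q U * h3 +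
    q ^ (r ^ 2 - r) * qInt q (2 * s + 1) * qInt (q ^ 2) g * aeval q U * aeval (q ^ 2) V * h4

theorem andrewsT_neg_eq (hq : ∀ k ≠ 0, q ^ k ≠ 1) (s : ℕ) :
    andrewsT (s + 1) (s + 1 + s) (-q) =
      q ^ ((s + 1) ^ 2 - (s + 1)) * qInt q (2 * s + 1) * qCatalan (q ^ 2) s := by
  have hq2 := sq_pow_ne_one hq
  have n1 := qInt_ne_zero (neg_pow_ne_one hq) (2 * s).succ_ne_zero
  have n2 := qInt_ne_zero hq2 s.succ_ne_zero
  refine mul_right_cancel₀ (mul_ne_zero n1 n2) ?_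
  -- Here t = 0, so the first Gaussian binomial is 1.
  have h1 := andrewsT_mul_qInt (neg_pow_ne_one hq) (add_zero (s + 1)).symm
  have he : Even ((s + 1) ^ 2 - (s + 1)) := by
    rw [show (s + 1) ^ 2 - (s + 1) = s * (s + 1) by
      rw [pow_two, ← Nat.sub_one_mul, Nat.add_sub_cancel]]
    exact Nat.even_mul_succ_self s
  rw [gauss_zero_right, map_one, neg_sq, he.neg_pow] at h1
  have h2 := congrArg (aeval (q ^ 2)) (qNum_mul_gauss_succ s s)
  simp only [map_mul, aeval_qNum] at h2
  rw [show s + 1 + s = 2 * s + 1 by omega] at h1 h2 ⊢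
  have h3 := qCatalan_eq hq2 s
  have h4 := qInt_mul_qInt_neg hq (odd_two_mul_add_one s)
  linear_combination qInt (q ^ 2) (s + 1) * h1 + q ^ ((s + 1) ^ 2 - (s + 1)) * (h2 -
    qInt (q ^ 2) (2 * s + 1) * h3 - qInt (q ^ 2) (s + 1) * qCatalan (q ^ 2) s * h4)

end Field

/-! ### Positive polynomials among rational functions -/

/-- Reconciles two ℤ-algebra instances on `RatFunc ℚ`: the one from its ring structure, used by the
field identities, and the one found in `IsPoly`. -/
theorem aeval_toIntAlgebra (f : RatFunc ℚ) (P : ℤ[X]) :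
    @aeval ℤ (RatFunc ℚ) _ _ (Ring.toIntAlgebra _) f P = aeval f P := by
  rw [Subsingleton.elim (Ring.toIntAlgebra (RatFunc ℚ)) (RatFunc.instAlgebraOfPolynomial ℚ ℤ)]

theorem IsPoly.mul {f g : RatFunc ℚ} (hf : IsPoly f) (hg : IsPoly g) : IsPoly (f * g) := by
  obtain ⟨P, rfl⟩ := hf
  obtain ⟨Q, rfl⟩ := hg
  exact ⟨P * Q, (map_mul _ _ _).symm⟩

theorem IsPositivePoly.isPoly {f : RatFunc ℚ} (hf : IsPositivePoly f) : IsPoly f :=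
  let ⟨P, _, h⟩ := hf
  ⟨P, h⟩

theorem IsPositivePoly.mul {f g : RatFunc ℚ} (hf : IsPositivePoly f) (hg : IsPositivePoly g) :
    IsPositivePoly (f * g) := by
  obtain ⟨P, hP, rfl⟩ := hf
  obtain ⟨Q, hQ, rfl⟩ := hg
  refine ⟨P * Q, fun k => ?_, (map_mul _ _ _).symm⟩
  rw [coeff_mul]
  exact Finset.sum_nonneg fun x _ => mul_nonneg (hP _) (hQ _)

theorem isPositivePoly_aeval {P : ℤ[X]} (hP : ∀ k, 0 ≤ P.coeff k) :
    IsPositivePoly (@aeval ℤ (RatFunc ℚ) _ _ (Ring.toIntAlgebra _) RatFunc.X P) :=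
  ⟨P, hP, aeval_toIntAlgebra _ _⟩

theorem isPositivePoly_aeval_sq {P : ℤ[X]} (hP : ∀ k, 0 ≤ P.coeff k) :
    IsPositivePoly (@aeval ℤ (RatFunc ℚ) _ _ (Ring.toIntAlgebra _) (RatFunc.X ^ 2) P) := by
  refine ⟨expand ℤ 2 P, fun k => ?_, by rw [aeval_toIntAlgebra, expand_aeval]⟩
  rw [coeff_expand two_pos]
  split_ifs
  · exact hP _
  · rfl

theorem isPositivePoly_zero : IsPositivePoly 0 := ⟨0, by simp⟩

theorem isPositivePoly_X_pow (n : ℕ) : IsPositivePoly (RatFunc.X ^ n : RatFunc ℚ) := by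
  refine ⟨X ^ n, fun k => ?_, by simp⟩
  rw [coeff_X_pow]
  split_ifs <;> norm_num

theorem isPositivePoly_one_add_X_pow (n : ℕ) :
    IsPositivePoly (1 + RatFunc.X ^ n : RatFunc ℚ) := by
  refine ⟨1 + X ^ n, fun k => ?_, by simp⟩
  rw [coeff_add, coeff_X_pow, coeff_one]
  split_ifs <;> norm_num

theorem isPositivePoly_qInt (n : ℕ) : IsPositivePoly (qInt (RatFunc.X : RatFunc ℚ) n) := by
  rw [← aeval_qNum]
  refine isPositivePoly_aeval fun k => ?_
  rw [qNum, finsetSum_coeff]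
  refine Finset.sum_nonneg fun i _ => ?_
  rw [coeff_X_pow]
  split_ifs <;> norm_num

theorem isPoly_qInt_neg (n : ℕ) : IsPoly (qInt (-RatFunc.X : RatFunc ℚ) n) :=
  ⟨∑ i ∈ Finset.range n, (-X) ^ i, by simp [qInt]⟩

theorem ratFunc_X_pow_ne_one (k : ℕ) (hk : k ≠ 0) : (RatFunc.X : RatFunc ℚ) ^ k ≠ 1 := by
  intro h
  have h1 : algebraMap ℚ[X] (RatFunc ℚ) (X ^ k) = algebraMap ℚ[X] (RatFunc ℚ) 1 := by
    rw [map_pow, RatFunc.algebraMap_X, h, map_one]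
  have h2 := congrArg natDegree (RatFunc.algebraMap_injective ℚ h1)
  rw [natDegree_X_pow, natDegree_one] at h2
  exact hk h2

theorem isPositivePoly_qCatalan_sq (n : ℕ) :
    IsPositivePoly (qCatalan ((RatFunc.X : RatFunc ℚ) ^ 2) n) := by
  obtain ⟨P, hP⟩ := qNum_succ_dvd_gauss_self n
  have hq := sq_pow_ne_one ratFunc_X_pow_ne_one
  have h : qCatalan ((RatFunc.X : RatFunc ℚ) ^ 2) n =
      @aeval ℤ (RatFunc ℚ) _ _ (Ring.toIntAlgebra _) (RatFunc.X ^ 2) P := by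
    refine mul_left_cancel₀ (qInt_ne_zero hq n.succ_ne_zero) ?_
    rw [qCatalan_eq hq, hP, map_mul, aeval_qNum]
  rw [h]
  refine isPositivePoly_aeval_sq (coeff_nonneg_of_qNum_mul_eq_gauss n.succ_ne_zero hP.symm)

/-! ### Integrality and positivity of Andrews' terms -/

/-- `T_r(n, q)` is a polynomial, which becomes positive after multiplication by `1 + q`. -/
theorem andrewsT_isPoly_and_positive (r s : ℕ) :
    IsPoly (andrewsT r (r + s) (RatFunc.X : RatFunc ℚ)) ∧
      IsPositivePoly ((1 + RatFunc.X) * andrewsT r (r + s) (RatFunc.X : RatFunc ℚ)) := by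
  rcases lt_or_ge (s + 1) r with h | h
  · rw [andrewsT_eq_zero h, mul_zero]
    exact ⟨isPositivePoly_zero.isPoly, isPositivePoly_zero⟩
  obtain ⟨t, ht⟩ := Nat.exists_eq_add_of_le h
  have hN : r + s + t = 2 * s + 1 := by omega
  set d := (2 * s + 1).gcd (r + s) with hd
  have hdN : d ∣ 2 * s + 1 := Nat.gcd_dvd_left _ _
  have hdn : d ∣ r + s := Nat.gcd_dvd_right _ _
  have hodd : Odd d := (odd_two_mul_add_one s).of_dvd_nat hdN
  -- A common divisor of d and r divides r + s, hence s, hence 1 = (2s+1) - 2s.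
  have hcop : d.Coprime r := by
    have h1 : d.gcd r ∣ s := (Nat.dvd_add_right (Nat.gcd_dvd_right d r)).1
      ((Nat.gcd_dvd_left d r).trans hdn)
    have h2 : d.gcd r ∣ 1 := (Nat.dvd_add_right (h1.mul_left 2)).1
      ((Nat.gcd_dvd_left d r).trans hdN)
    exact Nat.dvd_one.1 h2
  obtain ⟨P, hP⟩ : qNum (2 * s + 1) ∣ qNum d * gauss (r + s) t := by
    have := qNum_add_dvd_qNum_gcd_mul_gauss (r + s) t
    rwa [hN] at this
  obtain ⟨Q, hQ⟩ := qNum_dvd_gauss hdn hcop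
  have hPpos := coeff_nonneg_of_qNum_mul_eq (2 * s).succ_ne_zero hP.symm
  have hQpos := coeff_nonneg_of_qNum_mul_eq_gauss hodd.pos.ne' hQ.symm
  have hpos := ((isPositivePoly_X_pow (r ^ 2 - r)).mul (isPositivePoly_aeval hPpos)).mul
    (isPositivePoly_aeval_sq hQpos)
  rw [andrewsT_eq_mul_qInt_neg ratFunc_X_pow_ne_one ht hodd hP.symm hQ.symm]
  refine ⟨hpos.isPoly.mul (isPoly_qInt_neg d), ?_⟩
  rw [mul_left_comm, one_add_mul_qInt_neg _ hodd]
  exact hpos.mul (isPositivePoly_one_add_X_pow d)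

theorem andrewsT_isPositivePoly_of_even {r s : ℕ} (he : Even (r + s)) :
    IsPositivePoly (andrewsT r (r + s) (RatFunc.X : RatFunc ℚ)) := by
  rcases lt_or_ge (s + 1) r with h | h
  · rw [andrewsT_eq_zero h]
    exact isPositivePoly_zero
  obtain ⟨t, ht⟩ := Nat.exists_eq_add_of_le h
  obtain hn | ⟨m, hm⟩ : r + s = 0 ∨ ∃ m, m + 1 = r + s := by
    rcases r + s with _ | m
    · exact Or.inl rfl
    · exact Or.inr ⟨m, rfl⟩
  · obtain ⟨rfl, rfl⟩ : r = 0 ∧ s = 0 := by omega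
    refine ⟨1, fun k => ?_, ?_⟩
    · rw [coeff_one]; split_ifs <;> norm_num
    · simp [andrewsT, qPoch, qBinom, qCatalan, qFact, qInt]
  set g := (r + s).gcd r with hg
  have hg0 : g ≠ 0 := Nat.gcd_ne_zero_left (by omega)
  have hgn : g ∣ r + s := Nat.gcd_dvd_left _ _
  have hgs : g ∣ s := (Nat.dvd_add_right (Nat.gcd_dvd_right (r + s) r)).1 hgn
  -- m = n - 1 is odd as n is even, and is prime to n, hence to its divisor g.
  have hcop : (2 * g).Coprime m := by
    refine Nat.Coprime.mul_left ?_ ?_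
    · rw [Nat.coprime_two_left]
      rw [← hm] at he
      exact Nat.not_even_iff_odd.1 (Nat.even_add_one.1 he)
    · refine Nat.Coprime.coprime_dvd_left hgn ?_
      simp [← hm]
  obtain ⟨U, hU⟩ : qNum (2 * g) ∣ gauss m t :=
    qNum_dvd_gauss (by rw [show m + t = 2 * s by omega]; exact mul_dvd_mul_left 2 hgs) hcop
  obtain ⟨V, hV⟩ := qNum_add_dvd_qNum_gcd_mul_gauss r s
  have hUpos := coeff_nonneg_of_qNum_mul_eq_gauss (M := 2 * g) (by omega) hU.symm
  have hVpos := coeff_nonneg_of_qNum_mul_eq (M := r + s) (by omega) hV.symm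
  rw [andrewsT_eq_mul_one_add_pow ratFunc_X_pow_ne_one ht hm hg0 hU.symm hV.symm]
  exact (((isPositivePoly_X_pow _).mul (isPositivePoly_aeval hUpos)).mul
    (isPositivePoly_aeval_sq hVpos)).mul (isPositivePoly_one_add_X_pow _)

end KoshyQ

theorem mainTheorem1 :
    (∀ n r : ℕ, r ≤ n →
      KoshyQ.IsPoly (KoshyQ.andrewsT r n (RatFunc.X : RatFunc ℚ)) ∧
      (Even n → KoshyQ.IsPositivePoly (KoshyQ.andrewsT r n (RatFunc.X : RatFunc ℚ))) ∧
      (Odd n → KoshyQ.IsPositivePoly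
        ((1 + RatFunc.X) * KoshyQ.andrewsT r n (RatFunc.X : RatFunc ℚ)))) ∧
    (∀ r : ℕ, 1 ≤ r →
      KoshyQ.andrewsT r (2 * r - 1) (-RatFunc.X : RatFunc ℚ) =
        (RatFunc.X : RatFunc ℚ) ^ (r ^ 2 - r) *
          KoshyQ.qInt (RatFunc.X : RatFunc ℚ) (2 * r - 1) *
          KoshyQ.qCatalan ((RatFunc.X : RatFunc ℚ) ^ 2) (r - 1) ∧
      KoshyQ.IsPositivePoly (KoshyQ.andrewsT r (2 * r - 1) (-RatFunc.X : RatFunc ℚ))) := by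
  refine ⟨fun n r hr => ?_, fun r hr => ?_⟩
  · obtain ⟨s, rfl⟩ := Nat.exists_eq_add_of_le hr
    obtain ⟨h1, h2⟩ := KoshyQ.andrewsT_isPoly_and_positive r s
    exact ⟨h1, KoshyQ.andrewsT_isPositivePoly_of_even, fun _ => h2⟩
  · obtain ⟨s, rfl⟩ := Nat.exists_eq_add_of_le' hr
    have h := KoshyQ.andrewsT_neg_eq KoshyQ.ratFunc_X_pow_ne_one s
    rw [show 2 * (s + 1) - 1 = s + 1 + s by omega, Nat.add_sub_cancel, h,
      show s + 1 + s = 2 * s + 1 by omega]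
    exact ⟨rfl, ((KoshyQ.isPositivePoly_X_pow _).mul (KoshyQ.isPositivePoly_qInt _)).mul
      (KoshyQ.isPositivePoly_qCatalan_sq s)⟩
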